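/- Let $\mathcal C$ be a symmetric monoidal category (unit object $K$, symmetry $c$; associativity and unit constraints are suppressed, and $X$ also denotes $id_X$) with equalizers and coequalizers. A unital magma is an object $A$ with morphisms $\eta_A:K\to A$, $\mu_A:A\otimes A\to A$ such that $\mu_A\circ(\eta_A\otimes A)=id_A=\mu_A\circ(A\otimes\eta_A)$; put $\mu_{A\otimes B}=(\mu_A\otimes\mu_B)\circ(A\otimes c_{B,A}\otimes B)$. For a comonoid $(D,\varepsilon_D,\delta_D)$, a unital magma $A$ and $f,g:D\to A$, put $f*g=\mu_A\circ(f\otimes g)\circ\delta_D$. Let $H$ be a Hopf quasigroup in $\mathcal C$: a unital magma and a comonoid $(H,\varepsilon_H,\delta_H)$ such that $\varepsilon_H,\delta_H$ are morphisms of unital magmas, with a morphism $\lambda_H:H\to H$ such that $$\mu_H\circ(\lambda_H\otimes\mu_H)\circ(\delta_H\otimes H)=\varepsilon_H\otimes H=\mu_H\circ(H\otimes\mu_H)\circ(H\otimes\lambda_H\otimes H)\circ(\delta_H\otimes H),$$ $$\mu_H\circ(\mu_H\otimes\lambda_H)\circ(H\otimes\delta_H)=H\otimes\varepsilon_H=\mu_H\circ(\mu_H\otimes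 H)\circ(H\otimes\lambda_H\otimes H)\circ(H\otimes\delta_H).$$ Let $(A,\rho_A)$ be a right $H$-comodule magma: a unital magma with a counital coassociative coaction $\rho_A:A\to A\otimes H$ such that $\rho_A\circ\mu_A=\mu_{A\otimes H}\circ(\rho_A\otimes\rho_A)$ and $\rho_A\circ\eta_A=\eta_A\otimes\eta_H$. Let $i_A:A^{coH}\to A$ be the equalizer of $\rho_A$ and $(A\otimes(id_H*\lambda_H))\circ\rho_A$, and let $\eta_{A^{coH}}$, $\mu_{A^{coH}}$ be the factorizations of $\eta_A$ and $\mu_A\circ(i_A\otimes i_A)$ through $i_A$. Assume that $$\mu_A\circ(A\otimes(\mu_A\circ(i_A\otimes A)))=\mu_A\circ((\mu_A\circ(A\otimes i_A))\otimes A),\qquad \mu_A\circ(A\otimes(\mu_A\circ(A\otimes i_A)))=\mu_A\circ(\mu_A\otimes i_A),$$ and that the functor $A\otimes-$ preserves coequalizers. Let $n_A:A\otimes A\to A\otimes_{A^{coH}}A$ be the coequalizer of $(\mu_A\circ(A\otimes i_A))\otimes A$ and $A\otimes(\mu_A\circ(i_A\otimes A))$; let $\gamma_A:A\otimes_{A^{coH}}A\to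 A\otimes H$ be the morphism with $\gamma_A\circ n_A=(\mu_A\otimes H)\circ(A\otimes\rho_A)$, and $\varphi:A\otimes(A\otimes_{A^{coH}}A)\to A\otimes_{A^{coH}}A$ the morphism with $\varphi\circ(A\otimes n_A)=n_A\circ(\mu_A\otimes A)$. The left $A^{coH}$-actions on $A$ and $A^{coH}\otimes H$ are $\mu_A\circ(i_A\otimes A)$ and $\mu_{A^{coH}}\otimes H$, and $H$ coacts on $A^{coH}\otimes H$ by $A^{coH}\otimes\delta_H$. Then the following assertions are equivalent. (i) $A^{coH}\hookrightarrow A$ is an $H$-Galois extension, that is, $\gamma_A$ is an isomorphism; $\gamma_A^{-1}$ is almost lineal, that is, $\gamma_A^{-1}=\varphi\circ(A\otimes(\gamma_A^{-1}\circ(\eta_A\otimes H)))$; and $A^{coH}\hookrightarrow A$ has a normal basis, that is, there are an idempotent morphism $\Omega_A$ of left $A^{coH}$-modules and right $H$-comodules on $A^{coH}\otimes H$, with splitting $\Omega_A=s_A\circ r_A$, $r_A\circ s_A=id$ through an object $A^{coH}\times H$, and an isomorphism $b_A:A\to A^{coH}\times H$ of left $A^{coH}$-modules and right $H$-comodules (for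 the structures on $A^{coH}\times H$ induced along $r_A$ and $s_A$), which can moreover be chosen with $\Omega_A=id_{A^{coH}\otimes H}$ and $b_A\circ\eta_A=\eta_{A^{coH}}\otimes\eta_H$ (where $A^{coH}\times H$ is identified with $A^{coH}\otimes H$ by $s_A$). (ii) $A^{coH}\hookrightarrow A$ is an $H$-cleft extension ($A$ is a cleft right $H$-comodule algebra), that is, there are a morphism $h:H\to A$ of right $H$-comodules with $h\circ\eta_H=\eta_A$ and a morphism $h^{-1}:H\to A$ such that $h^{-1}*h=\varepsilon_H\otimes\eta_A=h*h^{-1}$ and $$(A\otimes\mu_H)\circ(c_{H,A}\otimes H)\circ(H\otimes(\rho_A\circ h^{-1}))\circ\delta_H=h^{-1}\otimes\eta_H,$$ $$\mu_A\circ(\mu_A\otimes A)\circ(A\otimes h^{-1}\otimes h)\circ(A\otimes\delta_H)=A\otimes\varepsilon_H,$$ $$\mu_A\circ(\mu_A\otimes A)\circ(A\otimes h\otimes h^{-1})\circ(A\otimes\delta_H)=\mu_A\circ(A\otimes(h*h^{-1})).$$ -/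

import Mathlib

open CategoryTheory MonoidalCategory Limits

universe v u

namespace HopfQG

section Basic

variable {C : Type u} [Category.{v} C] [MonoidalCategory C]

/-- A unital magma in a monoidal category: an object with a unit and a (not necessarily
associative) product for which the unit is two-sided. -/
class UnitalMagma (A : C) where
  /-- the unit -/
  one : 𝟙_ C ⟶ A
  /-- the product -/
  mul : A ⊗ A ⟶ A
  one_mul : one ▷ A ≫ mul = (λ_ A).hom
  mul_one : A ◁ one ≫ mul = (ρ_ A).hom

/-- The unit of a unital magma. -/
abbrev one (A : C) [UnitalMagma A] : 𝟙_ C ⟶ A := UnitalMagma.one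

/-- The product of a unital magma. -/
abbrev mul (A : C) [UnitalMagma A] : A ⊗ A ⟶ A := UnitalMagma.mul

/-- The counit of a comonoid. -/
abbrev counit (D : C) [ComonObj D] : D ⟶ 𝟙_ C := ComonObj.counit

/-- The coproduct of a comonoid. -/
abbrev comul (D : C) [ComonObj D] : D ⟶ D ⊗ D := ComonObj.comul

/-- The convolution product of two morphisms from a comonoid to a unital magma. -/
def conv {D A : C} [ComonObj D] [UnitalMagma A] (f g : D ⟶ A) : D ⟶ A :=
  comul D ≫ (f ⊗ₘ g) ≫ mul A

end Basic

variable {C : Type u} [Category.{v} C] [MonoidalCategory C] [SymmetricCategory C]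

/-- The product of the tensor product of two unital magmas,
`(μ_A ⊗ μ_B) ∘ (A ⊗ c_{B,A} ⊗ B)`. -/
def tensorMul (A B : C) [UnitalMagma A] [UnitalMagma B] : (A ⊗ B) ⊗ (A ⊗ B) ⟶ A ⊗ B :=
  tensorμ A B A B ≫ (mul A ⊗ₘ mul B)

/-- A Hopf quasigroup in a symmetric monoidal category: a unital magma and a comonoid whose counit
and coproduct are morphisms of unital magmas, with an antipode satisfying (in Sweedler notation)
`λ(h₁)(h₂ g) = ε(h) g = h₁ (λ(h₂) g)` and `(h g₁) λ(g₂) = h ε(g) = (h λ(g₁)) g₂`. -/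
class HopfQuasigroup (H : C) extends UnitalMagma H, ComonObj H where
  one_counit : HopfQG.one H ≫ HopfQG.counit H = 𝟙 (𝟙_ C)
  mul_counit : HopfQG.mul H ≫ HopfQG.counit H =
    (HopfQG.counit H ⊗ₘ HopfQG.counit H) ≫ (λ_ (𝟙_ C)).hom
  one_comul : HopfQG.one H ≫ HopfQG.comul H =
    (λ_ (𝟙_ C)).inv ≫ (HopfQG.one H ⊗ₘ HopfQG.one H)
  mul_comul : HopfQG.mul H ≫ HopfQG.comul H =
    (HopfQG.comul H ⊗ₘ HopfQG.comul H) ≫ tensorMul H H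
  /-- the antipode -/
  antipode : H ⟶ H
  antipode_mul_left : HopfQG.comul H ▷ H ≫ (α_ H H H).hom ≫ (antipode ⊗ₘ HopfQG.mul H) ≫
    HopfQG.mul H = HopfQG.counit H ▷ H ≫ (λ_ H).hom
  mul_antipode_left : HopfQG.comul H ▷ H ≫ (α_ H H H).hom ≫
    H ◁ (antipode ▷ H ≫ HopfQG.mul H) ≫ HopfQG.mul H = HopfQG.counit H ▷ H ≫ (λ_ H).hom
  mul_antipode_right : H ◁ HopfQG.comul H ≫ (α_ H H H).inv ≫ (HopfQG.mul H ⊗ₘ antipode) ≫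
    HopfQG.mul H = H ◁ HopfQG.counit H ≫ (ρ_ H).hom
  antipode_mul_right : H ◁ HopfQG.comul H ≫ (α_ H H H).inv ≫
    (H ◁ antipode ≫ HopfQG.mul H) ▷ H ≫ HopfQG.mul H = H ◁ HopfQG.counit H ≫ (ρ_ H).hom

/-- The target morphism `Π_H^L = id_H * λ_H`. -/
def targetMap (H : C) [HopfQuasigroup H] : H ⟶ H := conv (𝟙 H) HopfQuasigroup.antipode

/-- A right `H`-comodule magma over a Hopf quasigroup `H`: a unital magma `A` with a counital and
coassociative coaction that is compatible with the products and the units. -/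
class ComoduleMagma (H A : C) [HopfQuasigroup H] [UnitalMagma A] where
  /-- the coaction -/
  coact : A ⟶ A ⊗ H
  coact_counit : coact ≫ A ◁ counit H = (ρ_ A).inv
  coact_coact : coact ≫ coact ▷ H ≫ (α_ A H H).hom = coact ≫ A ◁ comul H
  mul_coact : mul A ≫ coact = (coact ⊗ₘ coact) ≫ tensorMul A H
  one_coact : one A ≫ coact = (λ_ (𝟙_ C)).inv ≫ (one A ⊗ₘ one H)

/-- The coaction `ρ_A : A ⟶ A ⊗ H`. -/
abbrev coact (H A : C) [HopfQuasigroup H] [UnitalMagma A] [ComoduleMagma H A] : A ⟶ A ⊗ H :=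
  ComoduleMagma.coact

lemma targetMap_eq (H : C) [HopfQuasigroup H] : targetMap H = counit H ≫ one H := by
  have h := congrArg (fun f => (λ_ H).inv ≫ one H ▷ H ≫ f)
    (HopfQuasigroup.mul_antipode_right (H := H))
  have hl : (λ_ H).inv ≫ one H ▷ H ≫ H ◁ comul H ≫ (α_ H H H).inv ≫
      (mul H ⊗ₘ HopfQuasigroup.antipode) ≫ mul H = targetMap H := by
    rw [← whisker_exchange_assoc, associator_inv_naturality_left_assoc,
      MonoidalCategory.tensorHom_def]
    rw [Category.assoc, ← comp_whiskerRight_assoc, UnitalMagma.one_mul, targetMap, conv,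
      MonoidalCategory.tensorHom_def]
    simp
  have hr : (λ_ H).inv ≫ one H ▷ H ≫ H ◁ counit H ≫ (ρ_ H).hom = counit H ≫ one H := by
    rw [← whisker_exchange_assoc]
    simp [← unitors_equal]
  exact hl.symm.trans (h.trans hr)

lemma unit_tensorMul (H A : C) [HopfQuasigroup H] [UnitalMagma A] :
    ((ρ_ A).inv ≫ A ◁ one H) ▷ (A ⊗ H) ≫ tensorMul A H = (α_ A A H).inv ≫ mul A ▷ H := by
  have h := tensorμ_natural_left_assoc (𝟙 A) (one H) A H (mul A ⊗ₘ mul H)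
  rw [id_tensorHom] at h
  rw [tensorMul, comp_whiskerRight, Category.assoc, h, tensorHom_comp_tensorHom,
    UnitalMagma.one_mul, id_whiskerRight, Category.id_comp]
  simp only [tensorμ, braiding_tensorUnit_left, MonoidalCategory.tensorHom_def']
  monoidal

section Coinvariants

variable (H A : C) [HopfQuasigroup H] [UnitalMagma A] [ComoduleMagma H A]

variable {A} in
lemma targetMap_of_coinvariant {X : C} (f : X ⟶ A) (g : X ⟶ A ⊗ 𝟙_ C)
    (hf : f ≫ coact H A = g ≫ A ◁ one H) :
    f ≫ coact H A = f ≫ coact H A ≫ A ◁ targetMap H := by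
  rw [← Category.assoc, hf, Category.assoc, ← whiskerLeft_comp, targetMap_eq,
    ← Category.assoc (one H), HopfQuasigroup.one_counit, Category.id_comp]

variable [HasEqualizers C]

/-- The object of coinvariants `A^{co H}`, the equalizer of `ρ_A` and `(A ⊗ Π_H^L) ∘ ρ_A`. -/
noncomputable def coinv : C := equalizer (coact H A) (coact H A ≫ A ◁ targetMap H)

/-- The inclusion `i_A : A^{co H} ⟶ A`. -/
noncomputable def incl : coinv H A ⟶ A :=
  equalizer.ι (coact H A) (coact H A ≫ A ◁ targetMap H)

lemma incl_coact : incl H A ≫ coact H A = incl H A ≫ (ρ_ A).inv ≫ A ◁ one H := by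
  have h : incl H A ≫ coact H A = incl H A ≫ coact H A ≫ A ◁ targetMap H :=
    equalizer.condition _ _
  rw [h, targetMap_eq, whiskerLeft_comp, ← Category.assoc (coact H A),
    ComoduleMagma.coact_counit]

lemma incl_mul_coact : (incl H A ▷ A ≫ mul A) ≫ coact H A =
    incl H A ▷ A ≫ A ◁ coact H A ≫ (α_ A A H).inv ≫ mul A ▷ H := by
  rw [Category.assoc, ComoduleMagma.mul_coact, MonoidalCategory.tensorHom_def', Category.assoc,
    ← whisker_exchange_assoc, ← comp_whiskerRight_assoc, incl_coact, comp_whiskerRight,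
    Category.assoc, unit_tensorMul, whisker_exchange_assoc]

/-- The unit `η_{A^{co H}}`, the factorization of `η_A` through `i_A`. -/
noncomputable def coinvOne : 𝟙_ C ⟶ coinv H A :=
  equalizer.lift (one A) (by
    apply targetMap_of_coinvariant H _ ((λ_ (𝟙_ C)).inv ≫ one A ▷ 𝟙_ C)
    rw [ComoduleMagma.one_coact, MonoidalCategory.tensorHom_def, Category.assoc])

/-- The product `μ_{A^{co H}}`, the factorization of `μ_A ∘ (i_A ⊗ i_A)` through `i_A`. -/
noncomputable def coinvMul : coinv H A ⊗ coinv H A ⟶ coinv H A :=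
  equalizer.lift ((incl H A ⊗ₘ incl H A) ≫ mul A) (by
    apply targetMap_of_coinvariant H _ ((incl H A ⊗ₘ incl H A) ≫ mul A ≫ (ρ_ A).inv)
    rw [MonoidalCategory.tensorHom_def']
    simp only [Category.assoc]
    have h := incl_mul_coact H A
    rw [Category.assoc] at h
    rw [h, whisker_exchange_assoc, ← whiskerLeft_comp_assoc, incl_coact, whisker_exchange_assoc,
      rightUnitor_inv_naturality_assoc (mul A), ← whisker_exchange]
    simp)

lemma coinvOne_incl : coinvOne H A ≫ incl H A = one A := equalizer.lift_ι _ _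

lemma coinvMul_incl : coinvMul H A ≫ incl H A = (incl H A ⊗ₘ incl H A) ≫ mul A :=
  equalizer.lift_ι _ _

/-- The left action of `A^{co H}` on `A`. -/
noncomputable def coinvAct : coinv H A ⊗ A ⟶ A := incl H A ▷ A ≫ mul A

/-- The left action `μ_{A^{co H}} ⊗ H` of `A^{co H}` on `A^{co H} ⊗ H`. -/
noncomputable def coinvTensorAct : coinv H A ⊗ (coinv H A ⊗ H) ⟶ coinv H A ⊗ H :=
  (α_ (coinv H A) (coinv H A) H).inv ≫ coinvMul H A ▷ H

/-- The right coaction `X ⊗ δ_H` of `H` on `X ⊗ H`. -/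
def tensorCoact (X : C) : X ⊗ H ⟶ (X ⊗ H) ⊗ H :=
  X ◁ comul H ≫ (α_ X H H).inv

/-- `a (x c) = (a x) c` for `x` coinvariant:
`μ_A ∘ (A ⊗ (μ_A ∘ (i_A ⊗ A))) = μ_A ∘ ((μ_A ∘ (A ⊗ i_A)) ⊗ A)`. -/
def MiddleAssoc : Prop :=
  (α_ A (coinv H A) A).hom ≫ A ◁ (incl H A ▷ A ≫ mul A) ≫ mul A =
    (A ◁ incl H A ≫ mul A) ▷ A ≫ mul A

/-- `a (c x) = (a c) x` for `x` coinvariant: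
`μ_A ∘ (A ⊗ (μ_A ∘ (A ⊗ i_A))) = μ_A ∘ (μ_A ⊗ i_A)`. -/
def RightAssoc : Prop :=
  (α_ A A (coinv H A)).hom ≫ A ◁ (A ◁ incl H A ≫ mul A) ≫ mul A =
    (mul A ⊗ₘ incl H A) ≫ mul A

/-- A normal basis for `A^{co H} ⊆ A`: an idempotent `Ω` of left `A^{co H}`-modules and right
`H`-comodules on `A^{co H} ⊗ H`, a splitting of `Ω` through its image `A^{co H} × H`, and an
isomorphism `b` of left `A^{co H}`-modules and right `H`-comodules from `A` onto this image. -/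
structure NormalBasis where
  /-- the idempotent `Ω_A` -/
  Ω : coinv H A ⊗ H ⟶ coinv H A ⊗ H
  Ω_idem : Ω ≫ Ω = Ω
  Ω_act : coinv H A ◁ Ω ≫ coinvTensorAct H A = coinvTensorAct H A ≫ Ω
  Ω_coact : Ω ≫ tensorCoact H (coinv H A) = tensorCoact H (coinv H A) ≫ Ω ▷ H
  /-- the image `A^{co H} × H` of `Ω_A` -/
  img : C
  /-- the inclusion `s_A` of the image -/
  s : img ⟶ coinv H A ⊗ H
  /-- the projection `r_A` onto the image -/
  r : coinv H A ⊗ H ⟶ img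
  r_s : r ≫ s = Ω
  s_r : s ≫ r = 𝟙 img
  /-- the isomorphism `b_A` -/
  b : A ≅ img
  b_act : coinvAct H A ≫ b.hom = coinv H A ◁ b.hom ≫ (coinv H A ◁ s ≫ coinvTensorAct H A ≫ r)
  b_coact : b.hom ≫ (s ≫ tensorCoact H (coinv H A) ≫ r ▷ H) = coact H A ≫ b.hom ▷ H

end Coinvariants

section Galois

variable [HasEqualizers C] [HasCoequalizers C]
variable (H A : C) [HopfQuasigroup H] [UnitalMagma A] [ComoduleMagma H A]

/-- The object `A ⊗_{A^{co H}} A`, the coequalizer of `(μ_A ∘ (A ⊗ i_A)) ⊗ A` and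
`A ⊗ (μ_A ∘ (i_A ⊗ A))`. -/
noncomputable def balTensor : C :=
  coequalizer ((A ◁ incl H A ≫ mul A) ▷ A)
    ((α_ A (coinv H A) A).hom ≫ A ◁ (incl H A ▷ A ≫ mul A))

/-- The projection `n_A : A ⊗ A ⟶ A ⊗_{A^{co H}} A`. -/
noncomputable def balProj : A ⊗ A ⟶ balTensor H A :=
  coequalizer.π ((A ◁ incl H A ≫ mul A) ▷ A)
    ((α_ A (coinv H A) A).hom ≫ A ◁ (incl H A ▷ A ≫ mul A))

/-- The canonical morphism `γ_A : A ⊗_{A^{co H}} A ⟶ A ⊗ H`, the factorization of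
`(μ_A ⊗ H) ∘ (A ⊗ ρ_A)` through `n_A`. -/
noncomputable def canMap (h₂ : MiddleAssoc H A) : balTensor H A ⟶ A ⊗ H :=
  coequalizer.desc (A ◁ coact H A ≫ (α_ A A H).inv ≫ mul A ▷ H) (by
    have h' := incl_mul_coact H A
    rw [Category.assoc (α_ A (coinv H A) A).hom, ← whiskerLeft_comp_assoc, h',
      ← whisker_exchange_assoc, ← whisker_exchange_assoc, associator_inv_naturality_left_assoc,
      ← comp_whiskerRight, ← h₂]
    simp)

lemma balProj_canMap (h₂ : MiddleAssoc H A) :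
    balProj H A ≫ canMap H A h₂ = A ◁ coact H A ≫ (α_ A A H).inv ≫ mul A ▷ H :=
  coequalizer.π_desc _ _

/-- The morphism `φ : A ⊗ (A ⊗_{A^{co H}} A) ⟶ A ⊗_{A^{co H}} A`, the factorization of
`n_A ∘ (μ_A ⊗ A)` through the coequalizer `A ⊗ n_A`. -/
noncomputable def balAct [PreservesColimitsOfShape WalkingParallelPair (tensorLeft A)]
    (h₃ : RightAssoc H A) : A ⊗ balTensor H A ⟶ balTensor H A :=
  Cofork.IsColimit.desc
    (isColimitOfHasCoequalizerOfPreservesColimit (tensorLeft A)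
      ((A ◁ incl H A ≫ mul A) ▷ A)
      ((α_ A (coinv H A) A).hom ≫ A ◁ (incl H A ▷ A ≫ mul A)))
    ((α_ A A A).inv ≫ mul A ▷ A ≫ balProj H A) (by
    have hc : (A ◁ incl H A ≫ mul A) ▷ A ≫ balProj H A =
      ((α_ A (coinv H A) A).hom ≫ A ◁ (incl H A ▷ A ≫ mul A)) ≫ balProj H A :=
      coequalizer.condition _ _
    change A ◁ ((A ◁ incl H A ≫ mul A) ▷ A) ≫ _ =
      A ◁ ((α_ A (coinv H A) A).hom ≫ A ◁ (incl H A ▷ A ≫ mul A)) ≫ _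
    have e : A ◁ ((A ◁ incl H A ≫ mul A) ▷ A) ≫ (α_ A A A).inv ≫ mul A ▷ A =
        A ◁ (α_ A (coinv H A) A).hom ≫ (α_ A A (coinv H A ⊗ A)).inv ≫
          (mul A) ▷ (coinv H A ⊗ A) ≫ (α_ A (coinv H A) A).inv ≫
          (A ◁ incl H A ≫ mul A) ▷ A := by
      have h := congrArg (fun f => (α_ A (A ⊗ coinv H A) A).inv ≫
        (α_ A A (coinv H A)).inv ▷ A ≫ f ▷ A) h₃
      rw [MonoidalCategory.tensorHom_def] at h
      simp at h
      simp [h]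
    have e' : A ◁ ((α_ A (coinv H A) A).hom ≫ A ◁ (incl H A ▷ A ≫ mul A)) ≫
          (α_ A A A).inv ≫ mul A ▷ A =
        A ◁ (α_ A (coinv H A) A).hom ≫ (α_ A A (coinv H A ⊗ A)).inv ≫
          (mul A) ▷ (coinv H A ⊗ A) ≫ A ◁ (incl H A ▷ A ≫ mul A) := by
      rw [← whisker_exchange]
      simp
    have h₁ := congrArg (fun f => f ≫ balProj H A) e
    have h₂ := congrArg (fun f => f ≫ balProj H A) e'
    simp only [Category.assoc] at h₁ h₂ hc ⊢
    rw [h₁, h₂, hc, Iso.inv_hom_id_assoc])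

lemma balProj_balAct [PreservesColimitsOfShape WalkingParallelPair (tensorLeft A)]
    (h₃ : RightAssoc H A) :
    A ◁ balProj H A ≫ balAct H A h₃ = (α_ A A A).inv ≫ mul A ▷ A ≫ balProj H A :=
  Cofork.IsColimit.π_desc' (isColimitOfHasCoequalizerOfPreservesColimit (tensorLeft A) _ _) _ _

/-- `A^{co H} ⊆ A` is an `H`-Galois extension: `γ_A` is an isomorphism. -/
abbrev IsGalois (h₂ : MiddleAssoc H A) : Prop := IsIso (canMap H A h₂)

/-- The inverse of the canonical morphism of an `H`-Galois extension is almost lineal: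
`γ_A⁻¹ = φ ∘ (A ⊗ (γ_A⁻¹ ∘ (η_A ⊗ H)))`. -/
def InvAlmostLineal [PreservesColimitsOfShape WalkingParallelPair (tensorLeft A)]
    (h₂ : MiddleAssoc H A) (h₃ : RightAssoc H A) [IsGalois H A h₂] : Prop :=
  inv (canMap H A h₂) =
    A ◁ ((λ_ H).inv ≫ one A ▷ H ≫ inv (canMap H A h₂)) ≫ balAct H A h₃

end Galois

section Cleft

variable (H A : C) [HopfQuasigroup H] [UnitalMagma A] [ComoduleMagma H A]

/-- `h` is a cleaving morphism with companion `h'` (usually written `h⁻¹`) exhibiting `A` as a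
weak `H`-cleft extension of `A^{co H}`. -/
structure IsWeakCleaving (h h' : H ⟶ A) : Prop where
  /-- `h` is a morphism of right `H`-comodules -/
  colinear : h ≫ coact H A = comul H ≫ h ▷ H
  /-- `h' * h = ε_H ⊗ η_A` -/
  conv_left : conv h' h = counit H ≫ one A
  /-- `(A ⊗ μ_H) ∘ (c_{H,A} ⊗ H) ∘ (H ⊗ (ρ_A ∘ h')) ∘ δ_H = h' ⊗ η_H` -/
  coact_inv : comul H ≫ H ◁ (h' ≫ coact H A) ≫ (α_ H A H).inv ≫ (β_ H A).hom ▷ H ≫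
    (α_ A H H).hom ≫ A ◁ mul H = (ρ_ H).inv ≫ (h' ⊗ₘ one H)
  /-- `μ_A ∘ (μ_A ⊗ A) ∘ (A ⊗ h' ⊗ h) ∘ (A ⊗ δ_H) = A ⊗ ε_H` -/
  mul_inv_mul : A ◁ comul H ≫ A ◁ (h' ⊗ₘ h) ≫ (α_ A A A).inv ≫ mul A ▷ A ≫ mul A =
    A ◁ counit H ≫ (ρ_ A).hom
  /-- `μ_A ∘ (μ_A ⊗ A) ∘ (A ⊗ h ⊗ h') ∘ (A ⊗ δ_H) = μ_A ∘ (A ⊗ (h * h'))` -/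
  mul_mul_inv : A ◁ comul H ≫ A ◁ (h ⊗ₘ h') ≫ (α_ A A A).inv ≫ mul A ▷ A ≫ mul A =
    A ◁ conv h h' ≫ mul A

/-- `A^{co H} ⊆ A` is an `H`-cleft extension (`A` is a cleft right `H`-comodule algebra): it is
weak `H`-cleft by a cleaving morphism `h` that is total, with `h * h' = ε_H ⊗ η_A`. -/
def IsCleft : Prop :=
  ∃ h h' : H ⟶ A, IsWeakCleaving H A h h' ∧
    conv h h' = counit H ≫ one A ∧ one H ≫ h = one A

end Cleft

end HopfQG

/-! In Sweedler notation, with `h'` for the convolution inverse of `h`, everything rests on the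
operators `twist f` : a ⊗ k ↦ a f(k₁) ⊗ k₂ of A ⊗ H. The last two cleft axioms, once h * h' is
trivial, say exactly that `twist h` and `twist h'` are mutually inverse; the axiom on ρ ∘ h' says
ρ(h'(k)) = h'(k₂) ⊗ λ(k₁) (`isWeakCleaving_iff`).

From a cleaving, q(a) = a₀ h'(a₁) is coinvariant, and a ↦ q(a₀) ⊗ a₁ is inverse to c ⊗ k ↦ c h(k)
(`exists_normalBasis`). The inverse of γ is a ⊗ k ↦ [a h'(k₁) ⊗ h(k₂)] (`isIso_canMap`), and left
multiplication only touches its first leg, so it is almost lineal.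

Conversely, a normal basis e : A ≅ A^{coH} ⊗ H gives h(k) = e⁻¹(1 ⊗ k) and p = (id ⊗ ε) ∘ e. Let
h'(k) be the image of γ⁻¹(1 ⊗ k) under [a ⊗ c] ↦ a p(c). Almost lineality yields (a c₀) h'(c₁) = a
p(c), and since the elements a c₀ ⊗ c₁ exhaust A ⊗ H, every cleft axiom for h' follows from this
identity (`canLift_act_coact`, `galois_isCleft`). Full associativity is never available: only the
antipode laws and the two associativity hypotheses on coinvariants are used. -/

namespace HopfQG

/-! ### Right multiplication operators and twists on A ⊗ H. -/

section Operators

variable {C : Type u} [Category.{v} C] [MonoidalCategory C]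

/-- Right multiplication by the values of `f`, `a ⊗ k ↦ a f(k)`. -/
def act {D A : C} [UnitalMagma A] (f : D ⟶ A) : A ⊗ D ⟶ A := A ◁ f ≫ mul A

lemma one_act {D A : C} [UnitalMagma A] (f : D ⟶ A) :
    (λ_ D).inv ≫ one A ▷ D ≫ act f = f := by
  rw [act, ← whisker_exchange_assoc, UnitalMagma.one_mul]
  simp

end Operators

section Symmetric

variable {C : Type u} [Category.{v} C] [MonoidalCategory C] [SymmetricCategory C]

section Comonoid

variable {H : C} [HopfQuasigroup H]

lemma tensorCoact_natural {X Y : C} (f : X ⟶ Y) :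
    f ▷ H ≫ tensorCoact H Y = tensorCoact H X ≫ (f ▷ H) ▷ H := by
  rw [tensorCoact, tensorCoact, ← whisker_exchange_assoc]
  simp

lemma tensorCoact_natural_assoc {X Y Z : C} (f : X ⟶ Y) (g : (Y ⊗ H) ⊗ H ⟶ Z) :
    f ▷ H ≫ tensorCoact H Y ≫ g = tensorCoact H X ≫ (f ▷ H) ▷ H ≫ g := by
  simp only [← Category.assoc, tensorCoact_natural]

lemma tensorCoact_coassoc (X : C) :
    tensorCoact H X ≫ tensorCoact H X ▷ H = tensorCoact H X ≫ tensorCoact H (X ⊗ H) := by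
  have h := congrArg (fun f => X ◁ f) (ComonObj.comul_assoc (X := H))
  simp only [whiskerLeft_comp] at h
  have e : tensorCoact H X ≫ tensorCoact H X ▷ H =
      (X ◁ comul H ≫ X ◁ comul H ▷ H ≫ X ◁ (α_ H H H).hom) ≫
        X ◁ (α_ H H H).inv ≫ (α_ X (H ⊗ H) H).inv ≫ (α_ X H H).inv ▷ H := by
    simp [tensorCoact]
  rw [e, ← h]
  simp [tensorCoact]

lemma tensorCoact_coassoc_assoc (X : C) {Z : C} (g : ((X ⊗ H) ⊗ H) ⊗ H ⟶ Z) :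
    tensorCoact H X ≫ tensorCoact H X ▷ H ≫ g =
      tensorCoact H X ≫ tensorCoact H (X ⊗ H) ≫ g := by
  simp only [← Category.assoc, tensorCoact_coassoc]

lemma tensorCoact_counit (X : C) :
    tensorCoact H X ≫ (X ◁ counit H ≫ (ρ_ X).hom) ▷ H = 𝟙 (X ⊗ H) := by
  have h := congrArg (fun f => X ◁ f) (ComonObj.counit_comul (X := H))
  simp only [whiskerLeft_comp] at h
  have e : tensorCoact H X ≫ (X ◁ counit H ≫ (ρ_ X).hom) ▷ H =
      (X ◁ comul H ≫ X ◁ counit H ▷ H) ≫ X ◁ (λ_ H).hom := by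
    simp [tensorCoact]
  rw [e, h]
  simp

lemma tensorCoact_counit_assoc (X : C) {Z : C} (g : X ⊗ H ⟶ Z) :
    tensorCoact H X ≫ (X ◁ counit H ≫ (ρ_ X).hom) ▷ H ≫ g = g := by
  rw [← Category.assoc, tensorCoact_counit, Category.id_comp]

variable {A : C} [UnitalMagma A]

/-- The operator `a ⊗ k ↦ a f(k₁) ⊗ k₂`. -/
def twist (f : H ⟶ A) : A ⊗ H ⟶ A ⊗ H := tensorCoact H A ≫ act f ▷ H

lemma twist_tensorCoact (f : H ⟶ A) :
    twist f ≫ tensorCoact H A = tensorCoact H A ≫ twist f ▷ H := by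
  rw [twist, Category.assoc, tensorCoact_natural, ← tensorCoact_coassoc_assoc, comp_whiskerRight]

/-- Twists are colinear for the cofree coaction on A ⊗ H, so a composite of twists is recovered from
its A-component alone. Identities of the form a f(k₁) g(k₂) = a ε(k) thereby become invertibility
statements. -/
lemma twist_twist (f g : H ⟶ A) :
    twist f ≫ twist g = tensorCoact H A ≫ (twist f ≫ act g) ▷ H := by
  rw [comp_whiskerRight, ← Category.assoc, ← twist_tensorCoact, Category.assoc, ← twist]

/-- Translates the last two cleft axioms into operator form; evaluating at the unit of A gives back
the convolution product in `one_twist_act`. -/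
lemma twist_act (f g : H ⟶ A) :
    twist f ≫ act g =
      A ◁ comul H ≫ A ◁ (f ⊗ₘ g) ≫ (α_ A A A).inv ≫ mul A ▷ A ≫ mul A := by
  simp only [twist, act, tensorCoact, comp_whiskerRight, Category.assoc,
    ← whisker_exchange_assoc, MonoidalCategory.tensorHom_def', whiskerLeft_comp]
  simp

lemma one_twist_act (f g : H ⟶ A) :
    (λ_ H).inv ≫ one A ▷ H ≫ twist f ≫ act g = conv f g := by
  rw [twist, Category.assoc, tensorCoact_natural_assoc, ← comp_whiskerRight_assoc]
  have h : one A ▷ H ≫ act f = (λ_ H).hom ≫ f := by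
    rw [act, ← whisker_exchange_assoc, UnitalMagma.one_mul]; simp
  rw [h, conv, MonoidalCategory.tensorHom_def, act]
  simp [tensorCoact]

lemma one_counit_act :
    (λ_ H).inv ≫ one A ▷ H ≫ A ◁ counit H ≫ (ρ_ A).hom = counit H ≫ one A := by
  rw [← whisker_exchange_assoc]
  simp [← unitors_equal]

lemma whiskerLeft_counit_one_mul :
    A ◁ (counit H ≫ one A) ≫ mul A = A ◁ counit H ≫ (ρ_ A).hom := by
  rw [whiskerLeft_comp, Category.assoc, UnitalMagma.mul_one]

lemma one_twist (f : H ⟶ A) : (λ_ H).inv ≫ one A ▷ H ≫ twist f = comul H ≫ f ▷ H := by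
  have h : one A ▷ H ≫ act f = (λ_ H).hom ≫ f := by
    rw [act, ← whisker_exchange_assoc, UnitalMagma.one_mul]; simp
  rw [twist, tensorCoact_natural_assoc, ← comp_whiskerRight, h]
  simp [tensorCoact]

lemma twist_twist_eq_id {f g : H ⟶ A} (h : twist f ≫ act g = A ◁ counit H ≫ (ρ_ A).hom) :
    twist f ≫ twist g = 𝟙 (A ⊗ H) := by
  rw [twist_twist, h, tensorCoact_counit]

end Comonoid

end Symmetric

/-! ### One-sided multiplications on A ⊗ H. -/

section Braided

variable {C : Type u} [Category.{v} C] [MonoidalCategory C] [SymmetricCategory C]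

/-- The operator `a ⊗ l ⊗ k ↦ a ⊗ l k`. -/
def mulSnd (H A : C) [UnitalMagma H] : (A ⊗ H) ⊗ H ⟶ A ⊗ H := (α_ A H H).hom ≫ A ◁ mul H

/-- The operator `a ⊗ l ⊗ c ↦ a c ⊗ l`. -/
def mulFst (H A : C) [UnitalMagma A] : (A ⊗ H) ⊗ A ⟶ A ⊗ H :=
  (β_ A H).hom ▷ A ≫ (α_ H A A).hom ≫ H ◁ mul A ≫ (β_ H A).hom

/-- The operator `k ⊗ a ⊗ l ↦ a ⊗ k l`. -/
def mulSndLeft (H A : C) [UnitalMagma H] : H ⊗ (A ⊗ H) ⟶ A ⊗ H :=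
  H ◁ (β_ A H).hom ≫ (α_ H H A).inv ≫ mul H ▷ A ≫ (β_ H A).hom

section Magma

lemma mulFst_eq (H A : C) [UnitalMagma A] : mulFst H A =
    (α_ A H A).hom ≫ A ◁ (β_ H A).hom ≫ (α_ A A H).inv ≫ mul A ▷ H := by
  rw [mulFst, BraidedCategory.braiding_naturality_right, BraidedCategory.braiding_tensor_right_hom]
  simp only [Category.assoc, Iso.hom_inv_id_assoc]
  rw [← comp_whiskerRight_assoc, SymmetricCategory.symmetry]
  simp

lemma mulSndLeft_eq (H A : C) [UnitalMagma H] : mulSndLeft H A =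
    (α_ H A H).inv ≫ (β_ H A).hom ▷ H ≫ (α_ A H H).hom ≫ A ◁ mul H := by
  rw [mulSndLeft, BraidedCategory.braiding_naturality_left,
    BraidedCategory.braiding_tensor_left_hom]
  simp only [Category.assoc, Iso.inv_hom_id_assoc]
  rw [← whiskerLeft_comp_assoc, SymmetricCategory.symmetry]
  simp

/-- The H-factor l of a ⊗ l is a spectator: it can be braided to the far left, leaving a computation
in A alone. -/
lemma mulFst_mulFst {H A X : C} [UnitalMagma A] (g : X ⟶ A ⊗ H) (f : H ⟶ A) :
    (A ⊗ H) ◁ g ≫ (α_ (A ⊗ H) A H).inv ≫ mulFst H A ▷ H ≫ (A ⊗ H) ◁ f ≫ mulFst H A =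
      (β_ A H).hom ▷ X ≫ (α_ H A X).hom ≫
        H ◁ (A ◁ g ≫ (α_ A A H).inv ≫ mul A ▷ H ≫ act f) ≫ (β_ H A).hom := by
  have h : mulFst H A ▷ H ≫ (A ⊗ H) ◁ f ≫ mulFst H A =
      ((β_ A H).hom ▷ A ≫ (α_ H A A).hom ≫ H ◁ mul A) ▷ H ≫ (α_ H A H).hom ≫
        H ◁ act f ≫ (β_ H A).hom := by
    rw [mulFst, whisker_exchange_assoc, ← comp_whiskerRight_assoc]
    simp only [Category.assoc]
    rw [SymmetricCategory.symmetry]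
    simp [act]
  rw [h]
  simp only [comp_whiskerRight, Category.assoc, ← associator_inv_naturality_left_assoc]
  rw [whisker_exchange_assoc]
  simp

variable (H A : C) [UnitalMagma H] [UnitalMagma A]

lemma tensorMul_eq_mulFst_mulSnd : tensorMul A H =
    (α_ (A ⊗ H) A H).inv ≫ mulFst H A ▷ H ≫ mulSnd H A := by
  rw [mulFst_eq, tensorMul, tensorμ, mulSnd, MonoidalCategory.tensorHom_def]
  simp

/-- Multiplying the H-legs first suits `antipodeTwist`, whose braiding cancels the one appearing
here. -/
lemma tensorMul_eq_mulSnd_mulFst : tensorMul A H =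
    (A ⊗ H) ◁ (β_ A H).hom ≫ (α_ (A ⊗ H) H A).inv ≫ mulSnd H A ▷ A ≫ mulFst H A := by
  have h : mulSnd H A ▷ A ≫ (α_ A H A).hom ≫ A ◁ (β_ H A).hom =
      (α_ A H H).hom ▷ A ≫ (α_ A (H ⊗ H) A).hom ≫ A ◁ ((α_ H H A).hom ≫ H ◁ (β_ H A).hom ≫
        (α_ H A H).inv ≫ (β_ H A).hom ▷ H ≫ (α_ A H H).hom ≫ A ◁ mul H) := by
    have := BraidedCategory.braiding_naturality_left (mul H) A
    rw [BraidedCategory.braiding_tensor_left_hom] at this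
    simp only [Category.assoc] at this
    rw [← this, mulSnd]
    simp only [comp_whiskerRight, whiskerLeft_comp, Category.assoc,
      associator_naturality_middle_assoc]
  have h' : (A ⊗ H) ◁ (β_ A H).hom ≫ (α_ (A ⊗ H) H A).inv ≫ (α_ A H H).hom ▷ A ≫
      (α_ A (H ⊗ H) A).hom ≫ A ◁ ((α_ H H A).hom ≫ H ◁ (β_ H A).hom) =
      (α_ A H (A ⊗ H)).hom := by
    have : (A ⊗ H) ◁ (β_ A H).hom ≫ (α_ (A ⊗ H) H A).inv ≫ (α_ A H H).hom ▷ A ≫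
        (α_ A (H ⊗ H) A).hom ≫ A ◁ ((α_ H H A).hom ≫ H ◁ (β_ H A).hom) =
        (α_ A H (A ⊗ H)).hom ≫ A ◁ H ◁ ((β_ A H).hom ≫ (β_ H A).hom) := by
      monoidal
    rw [this, SymmetricCategory.symmetry, whiskerLeft_id, whiskerLeft_id, Category.comp_id]
  rw [mulFst_eq, reassoc_of% h]
  simp only [whiskerLeft_comp, Category.assoc] at h' ⊢
  rw [reassoc_of% h', tensorMul, tensorμ, MonoidalCategory.tensorHom_def']
  simp

/-- `a ⊗ l ⊗ c ↦ a c ⊗ l` is the product with `c ⊗ 1`. -/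
lemma tensorMul_unit : (A ⊗ H) ◁ ((ρ_ A).inv ≫ A ◁ one H) ≫ tensorMul A H = mulFst H A := by
  have h : (mulFst H A ▷ 𝟙_ C) ≫ (A ⊗ H) ◁ one H ≫ mulSnd H A =
      mulFst H A ▷ 𝟙_ C ≫ (ρ_ (A ⊗ H)).hom := by
    have : (A ⊗ H) ◁ one H ≫ mulSnd H A = (α_ A H (𝟙_ C)).hom ≫ A ◁ (H ◁ one H ≫ mul H) := by
      simp [mulSnd]
    rw [this, UnitalMagma.mul_one]
    simp
  rw [tensorMul_eq_mulFst_mulSnd, whiskerLeft_comp, Category.assoc,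
    associator_inv_naturality_right_assoc, whisker_exchange_assoc, h]
  simp

end Magma

section Antipode

variable (H A : C) [HopfQuasigroup H]

/-- Short for the antipode. -/
abbrev antipode (H : C) [HopfQuasigroup H] : H ⟶ H := HopfQuasigroup.antipode

/-- Here A is the spectator, so iterated left multiplication reduces to an identity in H, to which
the left antipode laws apply. -/
lemma mulSndLeft_mulSndLeft (f f' : H ⟶ H) :
    comul H ▷ (A ⊗ H) ≫ (α_ H H (A ⊗ H)).hom ≫ f ▷ (H ⊗ A ⊗ H) ≫
      H ◁ (f' ▷ (A ⊗ H) ≫ mulSndLeft H A) ≫ mulSndLeft H A =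
    H ◁ (β_ A H).hom ≫ (α_ H H A).inv ≫ (comul H ▷ H ≫ (α_ H H H).hom ≫ f ▷ (H ⊗ H) ≫
      H ◁ (f' ▷ H ≫ mul H) ≫ mul H) ▷ A ≫ (β_ H A).hom := by
  have h : (α_ H H (A ⊗ H)).hom ≫ f ▷ (H ⊗ A ⊗ H) ≫
      H ◁ (f' ▷ (A ⊗ H) ≫ mulSndLeft H A) ≫ mulSndLeft H A =
      (H ⊗ H) ◁ (β_ A H).hom ≫ (α_ H H (H ⊗ A)).hom ≫ f ▷ (H ⊗ H ⊗ A) ≫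
        H ◁ (f' ▷ (H ⊗ A) ≫ (α_ H H A).inv ≫ mul H ▷ A) ≫ (α_ H H A).inv ≫
          mul H ▷ A ≫ (β_ H A).hom := by
    simp only [mulSndLeft, ← whisker_exchange_assoc]
    simp only [whiskerLeft_comp, Category.assoc]
    rw [← whiskerLeft_comp_assoc H (β_ H A).hom, SymmetricCategory.symmetry, whiskerLeft_id,
      Category.id_comp]
    simp
  rw [h, ← whisker_exchange_assoc]
  simp

lemma braiding_counit :
    H ◁ (β_ A H).hom ≫ (α_ H H A).inv ≫ (counit H ▷ H ≫ (λ_ H).hom) ▷ A ≫ (β_ H A).hom =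
      counit H ▷ (A ⊗ H) ≫ (λ_ (A ⊗ H)).hom := by
  rw [comp_whiskerRight, Category.assoc, ← associator_inv_naturality_left_assoc,
    whisker_exchange_assoc, leftUnitor_whiskerRight, Category.assoc, Iso.inv_hom_id_assoc,
    leftUnitor_naturality_assoc, SymmetricCategory.symmetry, Category.comp_id]

lemma antipode_mulSndLeft :
    comul H ▷ (A ⊗ H) ≫ (α_ H H (A ⊗ H)).hom ≫ antipode H ▷ (H ⊗ A ⊗ H) ≫
      H ◁ (mulSndLeft H A) ≫ mulSndLeft H A = counit H ▷ (A ⊗ H) ≫ (λ_ (A ⊗ H)).hom := by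
  have h := mulSndLeft_mulSndLeft H A (antipode H) (𝟙 H)
  have h' := HopfQuasigroup.antipode_mul_left (H := H)
  rw [MonoidalCategory.tensorHom_def, Category.assoc] at h'
  simp only [id_whiskerRight, Category.id_comp] at h
  rw [h, h', braiding_counit]

lemma mulSndLeft_antipode :
    comul H ▷ (A ⊗ H) ≫ (α_ H H (A ⊗ H)).hom ≫
      H ◁ (antipode H ▷ (A ⊗ H) ≫ mulSndLeft H A) ≫ mulSndLeft H A =
        counit H ▷ (A ⊗ H) ≫ (λ_ (A ⊗ H)).hom := by
  have h := mulSndLeft_mulSndLeft H A (𝟙 H) (antipode H)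
  have h' := HopfQuasigroup.mul_antipode_left (H := H)
  simp only [id_whiskerRight, Category.id_comp] at h
  rw [h, h', braiding_counit]

end Antipode

end Braided

/-! ### The coaction forced on the convolution inverse by the antipode. -/

section Antipode

variable {C : Type u} [Category.{v} C] [MonoidalCategory C] [SymmetricCategory C]
variable {H A : C} [HopfQuasigroup H]

/-- The morphism `k ↦ f(k₂) ⊗ λ(k₁)`. -/
def antipodeTwist (f : H ⟶ A) : H ⟶ A ⊗ H := comul H ≫ (antipode H ⊗ₘ f) ≫ (β_ H A).hom

lemma antipodeTwist_eq (f : H ⟶ A) : antipodeTwist f =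
    comul H ≫ antipode H ▷ H ≫ H ◁ ((ρ_ H).inv ≫ (f ⊗ₘ one H)) ≫ mulSndLeft H A := by
  have h : (α_ H (𝟙_ C) H).inv ≫ (H ◁ one H ≫ mul H) ▷ H = H ◁ (λ_ H).hom := by
    rw [UnitalMagma.mul_one]; simp
  have h' : H ◁ ((ρ_ H).inv ≫ (f ⊗ₘ one H)) ≫ mulSndLeft H A =
      H ◁ ((ρ_ H).inv ≫ (β_ H (𝟙_ C)).hom) ≫ (α_ H (𝟙_ C) H).inv ≫
        ((H ◁ one H) ≫ mul H) ▷ H ≫ H ◁ f ≫ (β_ H A).hom := by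
    rw [mulSndLeft, ← whiskerLeft_comp_assoc, Category.assoc, BraidedCategory.braiding_naturality,
      MonoidalCategory.tensorHom_def]
    simp only [whiskerLeft_comp, Category.assoc, comp_whiskerRight,
      associator_inv_naturality_right_assoc, associator_inv_naturality_middle_assoc,
      whisker_exchange_assoc]
  rw [h', reassoc_of% h, antipodeTwist, MonoidalCategory.tensorHom_def]
  rw [braiding_tensorUnit_right, Iso.inv_hom_id_assoc, ← whiskerLeft_comp_assoc,
    Iso.inv_hom_id, whiskerLeft_id, Category.id_comp, Category.assoc]

lemma comul_mulSndLeft (p q : H ⟶ H) (u : H ⟶ A ⊗ H) :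
    comul H ≫ p ▷ H ≫ H ◁ (comul H ≫ q ▷ H ≫ H ◁ u ≫ mulSndLeft H A) ≫ mulSndLeft H A =
      comul H ≫ H ◁ u ≫ comul H ▷ (A ⊗ H) ≫ (α_ H H (A ⊗ H)).hom ≫ p ▷ (H ⊗ A ⊗ H) ≫
        H ◁ (q ▷ (A ⊗ H) ≫ mulSndLeft H A) ≫ mulSndLeft H A := by
  have h := ComonObj.comul_assoc (X := H)
  simp only [whiskerLeft_comp, Category.assoc]
  rw [← whisker_exchange_assoc, reassoc_of% h, whisker_exchange_assoc,
    associator_naturality_right_assoc]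
  simp only [whisker_exchange_assoc, ← whiskerLeft_comp_assoc]

/-- The compatibility of `f` with a map `g` that stands for `ρ ∘ f`, solved for `g`. -/
lemma comul_mulSndLeft_eq_iff (f : H ⟶ A) (g : H ⟶ A ⊗ H) :
    comul H ≫ H ◁ g ≫ mulSndLeft H A = (ρ_ H).inv ≫ (f ⊗ₘ one H) ↔ g = antipodeTwist f := by
  have hc (u : H ⟶ A ⊗ H) : comul H ≫ H ◁ u ≫ counit H ▷ (A ⊗ H) ≫ (λ_ (A ⊗ H)).hom = u := by
    have := ComonObj.counit_comul (X := H)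
    rw [whisker_exchange_assoc, reassoc_of% this]
    simp
  constructor
  -- The operators sending g to k₁ · g(k₂) and to λ(k₁) · g(k₂) are mutually inverse; each
  -- implication uses one of the two left antipode laws.
  · intro h
    have := comul_mulSndLeft (antipode H) (𝟙 H) g
    simp only [id_whiskerRight, Category.id_comp] at this
    rw [antipode_mulSndLeft, hc] at this
    rw [antipodeTwist_eq, ← h, this]
  · rintro rfl
    have := comul_mulSndLeft (𝟙 H) (antipode H) ((ρ_ H).inv ≫ (f ⊗ₘ one H))
    simp only [id_whiskerRight, Category.id_comp] at this
    rw [mulSndLeft_antipode, hc] at this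
    rw [antipodeTwist_eq, this]

lemma tensorCoact_mulSnd_antipode :
    tensorCoact H (A ⊗ H) ≫ mulSnd H A ▷ H ≫ (A ⊗ H) ◁ antipode H ≫ mulSnd H A =
      (A ⊗ H) ◁ counit H ≫ (ρ_ (A ⊗ H)).hom := by
  have h := congrArg (fun f => (α_ A H H).hom ≫ A ◁ f) (HopfQuasigroup.mul_antipode_right (H := H))
  have e : tensorCoact H (A ⊗ H) ≫ mulSnd H A ▷ H ≫ (A ⊗ H) ◁ antipode H ≫ mulSnd H A =
      (α_ A H H).hom ≫ A ◁ (H ◁ comul H ≫ (α_ H H H).inv ≫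
        (mul H ⊗ₘ HopfQuasigroup.antipode) ≫ mul H) := by
    rw [MonoidalCategory.tensorHom_def]
    simp [tensorCoact, mulSnd]
  rw [e]
  refine h.trans ?_
  simp

lemma tensorCoact_antipode_mulSnd :
    tensorCoact H A ≫ (A ⊗ H) ◁ antipode H ≫ mulSnd H A = A ◁ targetMap H := by
  rw [targetMap, conv, id_tensorHom]
  simp [tensorCoact, mulSnd]

variable [UnitalMagma A]

lemma antipodeTwist_tensorMul (f : H ⟶ A) :
    (A ⊗ H) ◁ antipodeTwist f ≫ tensorMul A H =
      tensorCoact H (A ⊗ H) ≫ ((A ⊗ H) ◁ antipode H ≫ mulSnd H A) ▷ H ≫ (A ⊗ H) ◁ f ≫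
        mulFst H A := by
  rw [tensorMul_eq_mulSnd_mulFst, antipodeTwist, ← whiskerLeft_comp_assoc]
  simp only [Category.assoc]
  rw [SymmetricCategory.symmetry, Category.comp_id, MonoidalCategory.tensorHom_def]
  simp only [whiskerLeft_comp, Category.assoc, comp_whiskerRight, tensorCoact,
      associator_inv_naturality_right_assoc, associator_inv_naturality_middle_assoc,
      whisker_exchange_assoc]

/-- `(u (c ⊗ k₁)) (f(k₃) ⊗ λ(k₂)) = (u (c ⊗ 1)) (f(k) ⊗ 1)`. -/
lemma tensorCoact_tensorMul_antipodeTwist (f : H ⟶ A) :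
    (A ⊗ H) ◁ tensorCoact H A ≫ (α_ (A ⊗ H) (A ⊗ H) H).inv ≫ tensorMul A H ▷ H ≫
      (A ⊗ H) ◁ antipodeTwist f ≫ tensorMul A H =
    (α_ (A ⊗ H) A H).inv ≫ mulFst H A ▷ H ≫ (A ⊗ H) ◁ f ≫ mulFst H A := by
  have e : (A ⊗ H) ◁ tensorCoact H A ≫ (α_ (A ⊗ H) (A ⊗ H) H).inv ≫
      ((α_ (A ⊗ H) A H).inv ≫ mulFst H A ▷ H ≫ mulSnd H A) ▷ H =
      (α_ (A ⊗ H) A H).inv ≫ mulFst H A ▷ H ≫ tensorCoact H (A ⊗ H) ≫ mulSnd H A ▷ H := by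
    rw [tensorCoact_natural_assoc]
    simp only [tensorCoact]
    monoidal
  -- Coassociativity gathers the H-legs into (l k₁) λ(k₂), which the right antipode law collapses
  -- without associativity of H.
  rw [antipodeTwist_tensorMul, tensorMul_eq_mulFst_mulSnd, reassoc_of% e,
    tensorCoact_natural_assoc (mulSnd H A), ← tensorCoact_coassoc_assoc, ← comp_whiskerRight_assoc,
    ← comp_whiskerRight_assoc, Category.assoc, tensorCoact_mulSnd_antipode,
    tensorCoact_counit_assoc]

/-- `(c ⊗ 1) (d ⊗ 1) = c d ⊗ 1`. -/
lemma unit_mulFst : ((ρ_ A).inv ≫ A ◁ one H) ▷ A ≫ mulFst H A =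
    mul A ≫ (ρ_ A).inv ≫ A ◁ one H := by
  have h : A ◁ (one H ▷ A ≫ (β_ H A).hom) = A ◁ ((λ_ A).hom ≫ (ρ_ A).inv ≫ A ◁ one H) := by
    rw [BraidedCategory.braiding_naturality_left, braiding_tensorUnit_left, Category.assoc]
  simp only [whiskerLeft_comp] at h
  rw [mulFst_eq, comp_whiskerRight, Category.assoc, associator_naturality_middle_assoc,
    reassoc_of% h, rightUnitor_inv_naturality_assoc, ← whisker_exchange]
  monoidal

end Antipode

/-! ### Coactions of products in a comodule magma. -/

section Comodule

variable {C : Type u} [Category.{v} C] [MonoidalCategory C] [SymmetricCategory C]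
variable {H A : C} [HopfQuasigroup H] [UnitalMagma A] [ComoduleMagma H A]

lemma coact_coact_right : coact H A ≫ coact H A ▷ H = coact H A ≫ tensorCoact H A := by
  have h := congrArg (fun f => f ≫ (α_ A H H).inv) (ComoduleMagma.coact_coact (H := H) (A := A))
  simpa [tensorCoact] using h

/-- The coaction of a₀ f(a₁) is a₀ f(a₃) ⊗ a₁ λ(a₂), and a₁ λ(a₂) collapses to the unit; this makes
a₀ f(a₁) coinvariant. -/
lemma coact_act_coact (f : H ⟶ A) (hf : f ≫ coact H A = antipodeTwist f) :
    (coact H A ≫ act f) ≫ coact H A = (coact H A ≫ act f) ≫ (ρ_ A).inv ≫ A ◁ one H := by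
  have h₁ : coact H A ≫ coact H A ▷ H ≫ tensorCoact H (A ⊗ H) =
      coact H A ≫ (coact H A ≫ tensorCoact H A) ▷ H := by
    rw [tensorCoact_natural, ← reassoc_of% coact_coact_right (H := H) (A := A),
      ← comp_whiskerRight, coact_coact_right]
  have h₂ : (coact H A ≫ tensorCoact H A) ▷ H ≫ ((A ⊗ H) ◁ antipode H ≫ mulSnd H A) ▷ H =
      ((ρ_ A).inv ≫ A ◁ one H) ▷ H := by
    rw [← comp_whiskerRight, Category.assoc, tensorCoact_antipode_mulSnd, targetMap_eq,
      whiskerLeft_comp, ← Category.assoc, ComoduleMagma.coact_counit]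
  rw [act, Category.assoc, Category.assoc, ComoduleMagma.mul_coact,
    MonoidalCategory.tensorHom_def', Category.assoc, ← whiskerLeft_comp_assoc, hf,
    whisker_exchange_assoc, antipodeTwist_tensorMul, reassoc_of% h₁, reassoc_of% h₂,
    ← whisker_exchange_assoc, unit_mulFst]
  simp

/-- The lift of the canonical morphism to `A ⊗ A`, `a ⊗ c ↦ a c₀ ⊗ c₁`. -/
def canLift (H A : C) [HopfQuasigroup H] [UnitalMagma A] [ComoduleMagma H A] : A ⊗ A ⟶ A ⊗ H :=
  A ◁ coact H A ≫ (α_ A A H).inv ≫ mul A ▷ H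

lemma canLift_counit : canLift H A ≫ A ◁ counit H ≫ (ρ_ A).hom = mul A := by
  have h := congrArg (fun f => A ◁ f) (ComoduleMagma.coact_counit (H := H) (A := A))
  simp only [whiskerLeft_comp] at h
  rw [canLift, Category.assoc, Category.assoc, ← whisker_exchange_assoc,
    ← associator_inv_naturality_right_assoc, reassoc_of% h]
  simp

lemma canLift_tensorCoact : canLift H A ≫ tensorCoact H A =
    A ◁ coact H A ≫ (α_ A A H).inv ≫ canLift H A ▷ H := by
  have h := congrArg (fun f => A ◁ f) (coact_coact_right (H := H) (A := A))
  simp only [whiskerLeft_comp] at h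
  have e : (α_ A A H).inv ≫ tensorCoact H (A ⊗ A) =
      A ◁ tensorCoact H A ≫ (α_ A (A ⊗ H) H).inv ≫ (α_ A A H).inv ▷ H := by
    simp only [tensorCoact]
    monoidal
  rw [canLift, Category.assoc, Category.assoc, tensorCoact_natural, reassoc_of% e,
    ← reassoc_of% h]
  simp

lemma whiskerLeft_canLift (h : H ⟶ A) (hh : h ≫ coact H A = comul H ≫ h ▷ H) :
    A ◁ h ≫ canLift H A = twist h := by
  rw [canLift, ← whiskerLeft_comp_assoc, hh, twist]
  simp [tensorCoact, act]

lemma one_coact_tensorMul :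
    (λ_ (A ⊗ H)).inv ≫ (one A ≫ coact H A) ▷ (A ⊗ H) ≫ tensorMul A H = 𝟙 (A ⊗ H) := by
  have e : one A ≫ coact H A = one A ≫ (ρ_ A).inv ≫ A ◁ one H := by
    rw [ComoduleMagma.one_coact, MonoidalCategory.tensorHom_def, rightUnitor_inv_naturality_assoc,
      unitors_inv_equal]
  rw [e, comp_whiskerRight, Category.assoc, unit_tensorMul, associator_inv_naturality_left_assoc,
    ← comp_whiskerRight, UnitalMagma.one_mul]
  simp

/-- Both sides equal a₀ p(c) ⊗ a₁: the left because p(c) is coinvariant, the right by cancelling the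
antipode and then using `hf` with a₁ as spectator. -/
lemma canLift_act_coact [HasEqualizers C] (f : H ⟶ A) (p : A ⟶ coinv H A)
    (hf : canLift H A ≫ act f = A ◁ (p ≫ incl H A) ≫ mul A) :
    canLift H A ≫ act f ≫ coact H A =
      canLift H A ≫ (coact H A ⊗ₘ antipodeTwist f) ≫ tensorMul A H := by
  have h₁ : canLift H A ≫ act f ≫ coact H A =
      coact H A ▷ A ≫ (A ⊗ H) ◁ (p ≫ incl H A) ≫ mulFst H A := by
    rw [reassoc_of% hf, ComoduleMagma.mul_coact, MonoidalCategory.tensorHom_def',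
      Category.assoc, ← whiskerLeft_comp_assoc, Category.assoc, incl_coact,
      whisker_exchange_assoc, ← Category.assoc p, whiskerLeft_comp, Category.assoc,
      tensorMul_unit]
  have h₂ : canLift H A ≫ (coact H A ⊗ₘ antipodeTwist f) ≫ tensorMul A H =
      coact H A ▷ A ≫ (A ⊗ H) ◁ coact H A ≫ (A ⊗ H) ◁ tensorCoact H A ≫
        (α_ (A ⊗ H) (A ⊗ H) H).inv ≫ tensorMul A H ▷ H ≫
          (A ⊗ H) ◁ antipodeTwist f ≫ tensorMul A H := by
    rw [canLift, MonoidalCategory.tensorHom_def, Category.assoc, Category.assoc, Category.assoc,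
      ← comp_whiskerRight_assoc, ComoduleMagma.mul_coact, ← whiskerLeft_comp_assoc (A ⊗ H),
      ← coact_coact_right, comp_whiskerRight_assoc, MonoidalCategory.tensorHom_def,
      whiskerLeft_comp_assoc]
    simp only [comp_whiskerRight, Category.assoc, associator_inv_naturality_middle_assoc]
    rw [← associator_inv_naturality_left_assoc, whisker_exchange_assoc]
  rw [h₁, h₂, tensorCoact_tensorMul_antipodeTwist, mulFst_mulFst]
  have h₃ : A ◁ coact H A ≫ (α_ A A H).inv ≫ mul A ▷ H ≫ act f =
      A ◁ (p ≫ incl H A) ≫ mul A := by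
    rw [← hf, canLift]; simp
  rw [h₃, mulFst, whisker_exchange_assoc]
  simp

end Comodule

/-! ### From a cleaving to a Galois extension with normal basis. -/

section CleftExtension

variable {C : Type u} [Category.{v} C] [MonoidalCategory C] [SymmetricCategory C]
variable {H A : C} [HopfQuasigroup H] [UnitalMagma A] [ComoduleMagma H A]

/-- The identity for h' * h need not be listed on the right: it is the third condition evaluated at
the unit of A. -/
lemma isWeakCleaving_iff {h h' : H ⟶ A} (ε : conv h h' = counit H ≫ one A) : IsWeakCleaving H A h h' ↔
    h ≫ coact H A = comul H ≫ h ▷ H ∧ h' ≫ coact H A = antipodeTwist h' ∧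
    twist h' ≫ act h = A ◁ counit H ≫ (ρ_ A).hom ∧
    twist h ≫ act h' = A ◁ counit H ≫ (ρ_ A).hom := by
  have e : comul H ≫ H ◁ (h' ≫ coact H A) ≫ mulSndLeft H A = (ρ_ H).inv ≫ (h' ⊗ₘ one H) ↔
      h' ≫ coact H A = antipodeTwist h' := comul_mulSndLeft_eq_iff h' _
  rw [mulSndLeft_eq] at e
  constructor
  · intro W
    refine ⟨W.colinear, e.1 W.coact_inv, ?_, ?_⟩
    · rw [twist_act, W.mul_inv_mul]
    · rw [twist_act, W.mul_mul_inv, ε, whiskerLeft_counit_one_mul]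
  · rintro ⟨h1, h2, h3, h4⟩
    refine ⟨h1, ?_, e.2 h2, ?_, ?_⟩
    · rw [← one_twist_act, h3, one_counit_act]
    · rw [← twist_act, h3]
    · rw [← twist_act, h4, ε, whiskerLeft_counit_one_mul]

variable [HasEqualizers C]

instance : Mono (incl H A) := equalizer.ι_mono

lemma coinv_mul_one : coinv H A ◁ coinvOne H A ≫ coinvMul H A = (ρ_ (coinv H A)).hom := by
  rw [← cancel_mono (incl H A), Category.assoc, coinvMul_incl, MonoidalCategory.tensorHom_def',
    Category.assoc, ← whiskerLeft_comp_assoc, coinvOne_incl, whisker_exchange_assoc, UnitalMagma.mul_one,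
    rightUnitor_naturality]

lemma incl_act_coact (h : H ⟶ A) (hh : h ≫ coact H A = comul H ≫ h ▷ H) :
    (incl H A ▷ H ≫ act h) ≫ coact H A = incl H A ▷ H ≫ twist h := by
  have e := congrArg (fun f => coinv H A ◁ h ≫ f) (incl_mul_coact H A)
  simp only [Category.assoc] at e
  rw [act, Category.assoc, Category.assoc, ← whisker_exchange_assoc, e, whisker_exchange_assoc,
    ← whiskerLeft_comp_assoc, hh, twist]
  simp [tensorCoact, act]

lemma MiddleAssoc.act (h₂ : MiddleAssoc H A) {D : C} (h : D ⟶ A) :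
    A ◁ (incl H A ▷ D ≫ act h) ≫ mul A =
      (α_ A (coinv H A) D).inv ≫ (A ◁ incl H A ≫ mul A) ▷ D ≫ HopfQG.act h := by
  have e : A ◁ (incl H A ▷ D ≫ HopfQG.act h) ≫ mul A = (α_ A (coinv H A) D).inv ≫
      (A ⊗ coinv H A) ◁ h ≫ (α_ A (coinv H A) A).hom ≫ A ◁ (incl H A ▷ A ≫ mul A) ≫ mul A := by
    rw [HopfQG.act, ← whisker_exchange_assoc]
    simp
  rw [e, h₂, whisker_exchange_assoc, HopfQG.act]

lemma MiddleAssoc.coinvTensorAct_act (h₂ : MiddleAssoc H A) (h : H ⟶ A) :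
    coinvTensorAct H A ≫ incl H A ▷ H ≫ HopfQG.act h =
      coinv H A ◁ (incl H A ▷ H ≫ HopfQG.act h) ≫ coinvAct H A := by
  have e := h₂.act h
  rw [coinvAct, whisker_exchange_assoc, e, coinvTensorAct, Category.assoc,
    ← comp_whiskerRight_assoc, coinvMul_incl, MonoidalCategory.tensorHom_def]
  simp

section Cleft

variable {h h' : H ⟶ A}

lemma exists_normalBasis (h₂ : MiddleAssoc H A) (hc : h ≫ coact H A = comul H ≫ h ▷ H)
    (hh' : h' ≫ coact H A = antipodeTwist h')
    (hl : twist h' ≫ act h = A ◁ counit H ≫ (ρ_ A).hom)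
    (hr : twist h ≫ act h' = A ◁ counit H ≫ (ρ_ A).hom) (h1 : one H ≫ h = one A) :
    IsIso (incl H A ▷ H ≫ act h) ∧
    ∃ N : NormalBasis H A, N.Ω = 𝟙 (coinv H A ⊗ H) ∧
      one A ≫ N.b.hom ≫ N.s = (λ_ (𝟙_ C)).inv ≫ (coinvOne H A ⊗ₘ one H) := by
  -- The projection q(a) = a₀ h'(a₁); it sends c h(k) to c ε(k).
  let q : A ⟶ coinv H A := equalizer.lift (coact H A ≫ act h')
    (targetMap_of_coinvariant H _ ((coact H A ≫ act h') ≫ (ρ_ A).inv) (by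
      rw [coact_act_coact h' hh', Category.assoc _ (ρ_ A).inv]))
  have hq : q ≫ incl H A = coact H A ≫ act h' := equalizer.lift_ι _ _
  have hq' : (incl H A ▷ H ≫ act h) ≫ q = coinv H A ◁ counit H ≫ (ρ_ (coinv H A)).hom := by
    rw [← cancel_mono (incl H A), Category.assoc, hq, ← Category.assoc, incl_act_coact h hc,
      Category.assoc, hr, ← whisker_exchange_assoc, Category.assoc, rightUnitor_naturality]
  have hcc : (incl H A ▷ H ≫ act h) ≫ coact H A =
      tensorCoact H (coinv H A) ≫ (incl H A ▷ H ≫ act h) ▷ H := by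
    rw [incl_act_coact h hc, twist, tensorCoact_natural_assoc, comp_whiskerRight]
  obtain ⟨b, hb, hbi⟩ : ∃ b : A ≅ coinv H A ⊗ H, b.hom = coact H A ≫ q ▷ H ∧
      b.inv = incl H A ▷ H ≫ act h := ⟨
    { hom := coact H A ≫ q ▷ H
      inv := incl H A ▷ H ≫ act h
      hom_inv_id := by
        rw [Category.assoc, ← comp_whiskerRight_assoc, hq, comp_whiskerRight_assoc,
          reassoc_of% coact_coact_right (H := H) (A := A)]
        rw [twist, Category.assoc] at hl
        rw [hl, ← Category.assoc, ComoduleMagma.coact_counit, Iso.inv_hom_id]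
      inv_hom_id := by
        rw [← Category.assoc, hcc, Category.assoc, ← comp_whiskerRight, hq',
          tensorCoact_counit] }, rfl, rfl⟩
  refine ⟨hbi ▸ b.isIso_inv, ⟨𝟙 _, by simp, by simp, by simp, _, 𝟙 _, 𝟙 _, by simp, by simp, b, ?_, ?_⟩,
    rfl, ?_⟩
  · rw [← cancel_mono b.inv]
    have e := h₂.coinvTensorAct_act h
    rw [← hbi] at e
    simp [e]
  · rw [hb, comp_whiskerRight, reassoc_of% coact_coact_right (H := H) (A := A)]
    simp [tensorCoact_natural]
  · change one A ≫ b.hom ≫ 𝟙 _ = _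
    rw [Category.comp_id, ← cancel_mono b.inv, Category.assoc, Category.assoc, b.hom_inv_id,
      Category.comp_id]
    rw [hbi, MonoidalCategory.tensorHom_def', Category.assoc, ← comp_whiskerRight_assoc, coinvOne_incl,
      act, ← whisker_exchange_assoc, ← whiskerLeft_comp_assoc, h1, UnitalMagma.one_mul]
    simp

lemma whiskerLeft_incl_act_canLift (h₂ : MiddleAssoc H A)
    (hc : h ≫ coact H A = comul H ≫ h ▷ H) :
    A ◁ (incl H A ▷ H ≫ act h) ≫ canLift H A =
      (α_ A (coinv H A) H).inv ≫ (A ◁ incl H A ≫ mul A) ▷ H ≫ twist h := by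
  rw [canLift, ← whiskerLeft_comp_assoc, incl_act_coact h hc]
  have e : A ◁ (incl H A ▷ H ≫ twist h) ≫ (α_ A A H).inv ≫ mul A ▷ H =
      (α_ A (coinv H A) H).inv ≫ tensorCoact H (A ⊗ coinv H A) ≫
        ((α_ A (coinv H A) H).hom ≫ A ◁ (incl H A ▷ H ≫ act h) ≫ mul A) ▷ H := by
    rw [twist, tensorCoact_natural_assoc]
    simp only [tensorCoact]
    monoidal
  rw [e, h₂.act, Iso.hom_inv_id_assoc, comp_whiskerRight, twist, tensorCoact_natural_assoc]

variable [HasCoequalizers C]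

instance : Epi (balProj H A) := coequalizer.π_epi

/-- On a ⊗ h(k) the canonical map is `twist h`, which `twist h'` undoes. -/
lemma isIso_canMap (h₂ : MiddleAssoc H A) (hc : h ≫ coact H A = comul H ≫ h ▷ H)
    (hl : twist h' ≫ act h = A ◁ counit H ≫ (ρ_ A).hom)
    (hr : twist h ≫ act h' = A ◁ counit H ≫ (ρ_ A).hom) [IsIso (incl H A ▷ H ≫ act h)] :
    canMap H A h₂ ≫ twist h' ≫ A ◁ h ≫ balProj H A = 𝟙 _ ∧
      (twist h' ≫ A ◁ h ≫ balProj H A) ≫ canMap H A h₂ = 𝟙 _ := by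
  constructor
  · rw [← cancel_epi (balProj H A), reassoc_of% balProj_canMap H A h₂]
    -- It suffices to test on a ⊗ c h(k) with c coinvariant: γ gives (ac) h(k₁) ⊗ k₂, `twist h'`
    -- returns ac ⊗ k, and [ac ⊗ h(k)] = [a ⊗ c h(k)] by balancing.
    rw [← cancel_epi (A ◁ (incl H A ▷ H ≫ act h))]
    have e := whiskerLeft_incl_act_canLift h₂ hc
    rw [canLift] at e
    have hb : (A ◁ incl H A ≫ mul A) ▷ A ≫ balProj H A =
      ((α_ A (coinv H A) A).hom ≫ A ◁ (incl H A ▷ A ≫ mul A)) ≫ balProj H A :=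
      coequalizer.condition _ _
    rw [reassoc_of% e, reassoc_of% twist_twist_eq_id hr, ← whisker_exchange_assoc, hb, act,
      ← whisker_exchange_assoc]
    simp
  · simp only [Category.assoc]
    rw [balProj_canMap]
    change twist h' ≫ A ◁ h ≫ canLift H A = _
    rw [whiskerLeft_canLift h hc, twist_twist_eq_id hl]

variable [PreservesColimitsOfShape WalkingParallelPair (tensorLeft A)]

lemma IsCleft.galois (h₂ : MiddleAssoc H A) (h₃ : RightAssoc H A) (hA : IsCleft H A) :
    ∃ _ : IsGalois H A h₂, InvAlmostLineal H A h₂ h₃ ∧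
      ∃ N : NormalBasis H A, N.Ω = 𝟙 (coinv H A ⊗ H) ∧
        one A ≫ N.b.hom ≫ N.s = (λ_ (𝟙_ C)).inv ≫ (coinvOne H A ⊗ₘ one H) := by
  obtain ⟨h, h', W, ε, h1⟩ := hA
  obtain ⟨hc, hh', hl, hr⟩ := (isWeakCleaving_iff ε).1 W
  obtain ⟨_, N⟩ := exists_normalBasis h₂ hc hh' hl hr h1
  obtain ⟨e₁, e₂⟩ := isIso_canMap h₂ hc hl hr
  have hG : IsGalois H A h₂ := ⟨_, e₁, e₂⟩
  refine ⟨hG, ?_, N⟩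
  have e : inv (canMap H A h₂) = twist h' ≫ A ◁ h ≫ balProj H A := IsIso.inv_eq_of_hom_inv_id e₁
  have e' : (λ_ H).inv ≫ one A ▷ H ≫ twist h' ≫ A ◁ h ≫ balProj H A =
      comul H ≫ h' ▷ H ≫ A ◁ h ≫ balProj H A := by
    rw [reassoc_of% one_twist h']
  rw [InvAlmostLineal, e, e', whiskerLeft_comp, whiskerLeft_comp, whiskerLeft_comp]
  simp only [Category.assoc]
  rw [balProj_balAct, twist, act, Category.assoc, ← whisker_exchange_assoc]
  simp only [tensorCoact, comp_whiskerRight, Category.assoc, whisker_assoc, Iso.inv_hom_id_assoc,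
    tensor_whiskerLeft]
  rw [← whiskerLeft_comp_assoc A (H ◁ h), whisker_exchange]
  simp

end Cleft

end CleftExtension

/-! ### From a Galois extension with normal basis to a cleaving. -/

section GaloisExtension

variable {C : Type u} [Category.{v} C] [MonoidalCategory C] [SymmetricCategory C]
variable {H A : C} [HopfQuasigroup H] [UnitalMagma A] [ComoduleMagma H A]

section NormalBasis

variable [HasEqualizers C]

/-- The isomorphism `A ≅ A^{co H} ⊗ H` given by a normal basis whose idempotent is trivial. -/
@[simps]
noncomputable def NormalBasis.iso (N : NormalBasis H A) (hN : N.Ω = 𝟙 _) : A ≅ coinv H A ⊗ H where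
  hom := N.b.hom ≫ N.s
  inv := N.r ≫ N.b.inv
  hom_inv_id := by rw [Category.assoc, ← Category.assoc N.s, N.s_r]; simp
  inv_hom_id := by simp [N.r_s, hN]

variable (e : A ≅ coinv H A ⊗ H)

lemma NormalBasis.iso_act (N : NormalBasis H A) (hN : N.Ω = 𝟙 _) :
    coinvAct H A ≫ (N.iso hN).hom = coinv H A ◁ (N.iso hN).hom ≫ coinvTensorAct H A := by
  have := N.b_act
  rw [iso_hom, ← Category.assoc, this]
  simp [N.r_s, hN]

lemma NormalBasis.iso_coact (N : NormalBasis H A) (hN : N.Ω = 𝟙 _) :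
    (N.iso hN).hom ≫ tensorCoact H (coinv H A) = coact H A ≫ (N.iso hN).hom ▷ H := by
  have := N.b_coact
  rw [iso_hom, comp_whiskerRight, ← Category.assoc (coact H A), ← this]
  simp only [Category.assoc]
  rw [← comp_whiskerRight, N.r_s, hN]
  simp

/-- The first component of `e : A ≅ A^{co H} ⊗ H`. -/
noncomputable def isoFst : A ⟶ coinv H A := e.hom ≫ coinv H A ◁ counit H ≫ (ρ_ _).hom

/-- The restriction of the inverse of `e : A ≅ A^{co H} ⊗ H` to `H`. -/
noncomputable def isoCleaving : H ⟶ A := (λ_ H).inv ≫ coinvOne H A ▷ H ≫ e.inv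

lemma isoCleaving_fst : isoCleaving e ≫ isoFst e = counit H ≫ coinvOne H A := by
  simp only [isoCleaving, isoFst, Category.assoc, Iso.inv_hom_id_assoc]
  rw [← whisker_exchange_assoc]
  simp [← unitors_equal]

variable {e}

/-- By left linearity, since c ⊗ k = c · (1 ⊗ k). -/
lemma inv_eq_incl_act (he : coinvAct H A ≫ e.hom = coinv H A ◁ e.hom ≫ coinvTensorAct H A) :
    e.inv = incl H A ▷ H ≫ act (isoCleaving e) := by
  have h₁ : coinv H A ◁ e.inv ≫ coinvAct H A = coinvTensorAct H A ≫ e.inv := by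
    rw [← cancel_mono e.hom, Category.assoc, he, ← whiskerLeft_comp_assoc]
    simp
  have h₂ : coinv H A ◁ ((λ_ H).inv ≫ coinvOne H A ▷ H) ≫ coinvTensorAct H A = 𝟙 _ := by
    have := congrArg (fun f => (ρ_ _).inv ▷ H ≫ f ▷ H) (coinv_mul_one (H := H) (A := A))
    simp only [comp_whiskerRight] at this
    rw [← comp_whiskerRight _ (ρ_ _).hom, Iso.inv_hom_id, id_whiskerRight] at this
    rw [← this, coinvTensorAct]
    simp
  rw [act, ← whisker_exchange_assoc]
  change _ = coinv H A ◁ isoCleaving e ≫ coinvAct H A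
  rw [isoCleaving, ← Category.assoc (λ_ H).inv, whiskerLeft_comp, Category.assoc, h₁,
    reassoc_of% h₂]

lemma isoFst_act (he : coinvAct H A ≫ e.hom = coinv H A ◁ e.hom ≫ coinvTensorAct H A) :
    coinvAct H A ≫ isoFst e = coinv H A ◁ isoFst e ≫ coinvMul H A := by
  rw [isoFst, ← Category.assoc, he, coinvTensorAct, Category.assoc, Category.assoc,
    ← whisker_exchange_assoc, rightUnitor_naturality]
  simp

/-- A colinear map into the cofree comodule is determined by its component under the counit. -/
lemma hom_eq_coact_isoFst (he' : e.hom ≫ tensorCoact H (coinv H A) = coact H A ≫ e.hom ▷ H) :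
    e.hom = coact H A ≫ isoFst e ▷ H := by
  have := congrArg (fun f => f ≫ (coinv H A ◁ counit H ≫ (ρ_ (coinv H A)).hom) ▷ H) he'
  simp only [Category.assoc] at this
  rw [tensorCoact_counit, Category.comp_id, ← comp_whiskerRight] at this
  exact this

lemma isoCleaving_coact (he' : e.hom ≫ tensorCoact H (coinv H A) = coact H A ≫ e.hom ▷ H) :
    isoCleaving e ≫ coact H A = comul H ≫ isoCleaving e ▷ H := by
  have h : e.inv ≫ coact H A = tensorCoact H (coinv H A) ≫ e.inv ▷ H := by
    rw [← cancel_epi e.hom, Iso.hom_inv_id_assoc, reassoc_of% he', ← comp_whiskerRight]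
    simp
  simp only [isoCleaving, Category.assoc]
  rw [h, tensorCoact_natural_assoc]
  simp [tensorCoact]

end NormalBasis

section Galois

variable [HasEqualizers C] [HasCoequalizers C]

/-- The morphism `A ⊗_{A^{co H}} A ⟶ A`, `a ⊗ c ↦ a p(c)`, for a left linear `p`. -/
noncomputable def balDesc (h₂ : MiddleAssoc H A) (p : A ⟶ coinv H A)
    (hp : coinvAct H A ≫ p = coinv H A ◁ p ≫ coinvMul H A) : balTensor H A ⟶ A :=
  coequalizer.desc (A ◁ (p ≫ incl H A) ≫ mul A) (by
    have h : coinvAct H A ≫ p ≫ incl H A = coinv H A ◁ (p ≫ incl H A) ≫ incl H A ▷ A ≫ mul A := by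
      rw [reassoc_of% hp, coinvMul_incl, MonoidalCategory.tensorHom_def']
      simp
    have h' : A ◁ (incl H A ▷ A ≫ mul A) ≫ A ◁ (p ≫ incl H A) =
        A ◁ coinv H A ◁ (p ≫ incl H A) ≫ A ◁ (incl H A ▷ A ≫ mul A) := by
      rw [← whiskerLeft_comp, ← whiskerLeft_comp, ← h, coinvAct]
    rw [← whisker_exchange_assoc, ← h₂, Category.assoc, reassoc_of% h',
      associator_naturality_right_assoc])

variable (h₂ : MiddleAssoc H A) {p : A ⟶ coinv H A}
    (hp : coinvAct H A ≫ p = coinv H A ◁ p ≫ coinvMul H A)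

lemma balProj_balDesc : balProj H A ≫ balDesc h₂ p hp = A ◁ (p ≫ incl H A) ≫ mul A :=
  coequalizer.π_desc _ _

variable [PreservesColimitsOfShape WalkingParallelPair (tensorLeft A)]

/-- On representatives this is (ab) p(c) = a (b p(c)), an instance of `RightAssoc`. -/
lemma balAct_balDesc (h₃ : RightAssoc H A) :
    balAct H A h₃ ≫ balDesc h₂ p hp = A ◁ balDesc h₂ p hp ≫ mul A := by
  have : Epi (A ◁ balProj H A) := by
    change Epi ((tensorLeft A).map (coequalizer.π _ _))
    infer_instance
  rw [← cancel_epi (A ◁ balProj H A), ← Category.assoc, balProj_balAct, ← whiskerLeft_comp_assoc,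
    balProj_balDesc, Category.assoc, Category.assoc, balProj_balDesc, ← whisker_exchange_assoc,
    whiskerLeft_comp (A ⊗ A), Category.assoc, whisker_exchange_assoc,
    ← MonoidalCategory.tensorHom_def_assoc, ← h₃]
  simp

lemma galois_isCleft (h₃ : RightAssoc H A) [IsGalois H A h₂] (hG : InvAlmostLineal H A h₂ h₃)
    (e : A ≅ coinv H A ⊗ H)
    (he : coinvAct H A ≫ e.hom = coinv H A ◁ e.hom ≫ coinvTensorAct H A)
    (he' : e.hom ≫ tensorCoact H (coinv H A) = coact H A ≫ e.hom ▷ H)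
    (he₁ : one A ≫ e.hom = (λ_ (𝟙_ C)).inv ≫ (coinvOne H A ⊗ₘ one H)) : IsCleft H A := by
  have hp := isoFst_act he
  let G : A ⊗ H ⟶ A := inv (canMap H A h₂) ≫ balDesc h₂ (isoFst e) hp
  let h' : H ⟶ A := (λ_ H).inv ≫ one A ▷ H ≫ G
  -- Almost lineality enters only here: it makes G determined by its values on 1 ⊗ k.
  have hGh' : G = act h' := by
    have := congrArg (fun f => f ≫ balDesc h₂ (isoFst e) hp) hG
    refine this.trans ?_
    rw [Category.assoc, balAct_balDesc, ← whiskerLeft_comp_assoc, act]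
    simp [h', G]
  have hcan : canLift H A = balProj H A ≫ canMap H A h₂ := (balProj_canMap H A h₂).symm
  -- An epimorphism followed by the isomorphism γ; identities on A ⊗ H may be tested on a c₀ ⊗ c₁.
  have : Epi (canLift H A) := by rw [hcan]; infer_instance
  have hf : canLift H A ≫ act h' = A ◁ (isoFst e ≫ incl H A) ≫ mul A := by
    rw [← hGh', hcan, Category.assoc, IsIso.hom_inv_id_assoc, balProj_balDesc]
  have hc := isoCleaving_coact he'
  -- Put c = h(k) in `hf`, where p(h(k)) = ε(k) 1.
  have hr : twist (isoCleaving e) ≫ act h' = A ◁ counit H ≫ (ρ_ A).hom := by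
    rw [← whiskerLeft_canLift _ hc, Category.assoc, hf, ← whiskerLeft_comp_assoc,
      reassoc_of% isoCleaving_fst, coinvOne_incl, whiskerLeft_counit_one_mul]
  -- On a c₀ ⊗ c₁ the left side is (a p(c₀)) h(c₁) = a (p(c₀) h(c₁)) = ac, as p(c₀) h(c₁) =
  -- e⁻¹(e(c)).
  have hl : twist h' ≫ act (isoCleaving e) = A ◁ counit H ≫ (ρ_ A).hom := by
    rw [← cancel_epi (canLift H A), canLift_counit, twist, Category.assoc,
      reassoc_of% canLift_tensorCoact, ← comp_whiskerRight_assoc, hf]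
    have h₁ : A ◁ coact H A ≫ (α_ A A H).inv ≫ (A ◁ (isoFst e ≫ incl H A) ≫ mul A) ▷ H =
        A ◁ (coact H A ≫ isoFst e ▷ H) ≫ (α_ A (coinv H A) H).inv ≫
          (A ◁ incl H A ≫ mul A) ▷ H := by
      simp
    rw [reassoc_of% h₁, ← h₂.act, ← hom_eq_coact_isoFst he', ← inv_eq_incl_act he,
      ← whiskerLeft_comp_assoc]
    simp
  -- The coaction formula is proved for all a h'(k), then specialized to a = 1.
  have hs : h' ≫ coact H A = antipodeTwist h' := by
    have hs' : act h' ≫ coact H A = (coact H A ⊗ₘ antipodeTwist h') ≫ tensorMul A H := by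
      rw [← cancel_epi (canLift H A)]
      exact canLift_act_coact _ _ hf
    have hs₂ := congrArg (fun f => (λ_ H).inv ≫ one A ▷ H ≫ f) hs'
    have ha : h' ≫ coact H A = (λ_ H).inv ≫ one A ▷ H ≫ act h' ≫ coact H A := by
      simpa only [Category.assoc] using congrArg (fun f => f ≫ coact H A) (one_act h').symm
    rw [ha, hs₂, MonoidalCategory.tensorHom_def', Category.assoc, ← whisker_exchange_assoc,
      ← leftUnitor_inv_naturality_assoc, ← comp_whiskerRight_assoc,
      one_coact_tensorMul, Category.comp_id]
  have ε : conv (isoCleaving e) h' = counit H ≫ one A := by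
    rw [← one_twist_act, hr, one_counit_act]
  refine ⟨isoCleaving e, h', (isWeakCleaving_iff ε).2 ⟨hc, hs, hl, hr⟩, ε, ?_⟩
  rw [← cancel_mono e.hom, he₁, isoCleaving]
  simp [MonoidalCategory.tensorHom_def']

end Galois

end GaloisExtension

end HopfQG

theorem corollary4p3 {C : Type u} [Category.{v} C] [MonoidalCategory C]
    [SymmetricCategory C] [HasEqualizers C] [HasCoequalizers C]
    (H A : C) [HopfQG.HopfQuasigroup H] [HopfQG.UnitalMagma A] [HopfQG.ComoduleMagma H A]
    (h₂ : HopfQG.MiddleAssoc H A) (h₃ : HopfQG.RightAssoc H A)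
    [PreservesColimitsOfShape WalkingParallelPair (tensorLeft A)] :
    (∃ _ : HopfQG.IsGalois H A h₂, HopfQG.InvAlmostLineal H A h₂ h₃ ∧
      ∃ N : HopfQG.NormalBasis H A, N.Ω = 𝟙 (HopfQG.coinv H A ⊗ H) ∧
        HopfQG.one A ≫ N.b.hom ≫ N.s =
          (λ_ (𝟙_ C)).inv ≫ (HopfQG.coinvOne H A ⊗ₘ HopfQG.one H)) ↔
    HopfQG.IsCleft H A := by
  refine ⟨?_, fun hA => hA.galois h₂ h₃⟩
  rintro ⟨_, hG, N, hN, hN₁⟩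
  exact HopfQG.galois_isCleft h₂ h₃ hG (N.iso hN) (N.iso_act hN) (N.iso_coact hN) hN₁
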